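/- Let $d\ge 1$, let $\Omega\subset\mathbb R^d$ be open, bounded and connected with Lipschitz boundary (locally the graph of a Lipschitz function), and let $T>0$, $c>0$. Equip $H^1_0(\Omega)$ with the norm $\|w\|_{H^1_0}=\|\nabla w\|_{L^2(\Omega)}$ and $H^{-1}(\Omega)=H^1_0(\Omega)^*$ with the dual norm, and write $L^2(X)$, $H^2(X)$ for the Bochner spaces of functions $(0,T)\to X$. Let $$\mathbb U=\{u\in L^2(H^1_0(\Omega))\cap H^2(H^{-1}(\Omega)) : u(0)=0,\ \partial_t u(0)=0\},\qquad \|u\|_{\mathbb U}^2=\|u\|_{L^2(H^1_0)}^2+\tfrac1{c^4}\|\partial_{tt}u\|_{L^2(H^{-1})}^2,$$ $$\mathbb V=L^2(H^1_0(\Omega)),\qquad \mathbb V^*=L^2(H^{-1}(\Omega)),$$ the last two with their Bochner norms. Let $\mathcal L=c^{-2}\partial_{tt}-\Delta:\mathbb U\to\mathbb V^*$ be the (bounded) weak wave operator, where $\langle-\Delta w,z\rangle=(\nabla w,\nabla z)_{L^2(\Omega)}$, and for $\kappa>0$ let $$\mathcal B_\kappa(u,v)=\int_0^T\big(\kappa\langle\partial_{tt}u,v\rangle+(\nabla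 u,\nabla v)_{L^2(\Omega)}\big)\,dt ,\qquad u\in\mathbb U,\ v\in\mathbb V .$$ Then $$\inf_{0\ne u\in\mathbb U}\ \sup_{0\ne v\in\mathbb V}\ \frac{\mathcal B_\kappa(u,v)}{\|u\|_{\mathbb U}\|v\|_{\mathbb V}}=0$$ both for $\kappa=c^{-2}$ (the form induced by $\mathcal L$) and for $\kappa=1$. Consequently there are no constants $0<C_1\le C_2$ with $C_1\|u\|_{\mathbb U}\le\|\mathcal Lu\|_{\mathbb V^*}\le C_2\|u\|_{\mathbb U}$ for all $u\in\mathbb U$, and $\mathcal L$ is not an isomorphism (linear homeomorphism) from $\mathbb U$ onto $\mathbb V^*$. -/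

import Mathlib

open MeasureTheory Set
open scoped ENNReal ContDiff

noncomputable section

namespace WaveInfSup

/-! ### The spatial domain -/

/-- The boundary of `Ω` is locally the graph of a Lipschitz function: near every boundary point there
are a direction `e` and a Lipschitz function `γ` of the coordinates orthogonal to `e` such that `Ω`
is locally the set of the points that lie strictly above the graph of `γ` in direction `e`. -/
def HasLipschitzBoundary {d : ℕ} (Ω : Set (EuclideanSpace ℝ (Fin d))) : Prop :=
  ∀ x ∈ frontier Ω, ∃ (e : EuclideanSpace ℝ (Fin d)) (r : ℝ) (K : NNReal)
    (γ : EuclideanSpace ℝ (Fin d) → ℝ), ‖e‖ = 1 ∧ 0 < r ∧ LipschitzWith K γ ∧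
      ∀ y ∈ Metric.ball x r, y ∈ Ω ↔ γ (y - inner ℝ e y • e) < inner ℝ e y

/-- Open, bounded, connected (in particular non-empty) subsets of `ℝᵈ`, `d ≥ 1`, with Lipschitz
boundary. -/
structure LipschitzDomain (d : ℕ) where
  carrier : Set (EuclideanSpace ℝ (Fin d))
  dim_pos : 0 < d
  isOpen : IsOpen carrier
  isBounded : Bornology.IsBounded carrier
  isConnected : IsConnected carrier
  hasLipschitzBoundary : HasLipschitzBoundary carrier

variable {d : ℕ}

/-- `L²(Ω)`. -/
abbrev L2 (Ω : LipschitzDomain d) : Type :=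
  Lp ℝ 2 (volume.restrict Ω.carrier)

/-- `L²(Ω)ᵈ`. -/
abbrev L2Vec (Ω : LipschitzDomain d) : Type :=
  Lp (EuclideanSpace ℝ (Fin d)) 2 (volume.restrict Ω.carrier)

/-- `φ ∈ C_c^∞(Ω)`. -/
def IsTest (Ω : LipschitzDomain d) (φ : EuclideanSpace ℝ (Fin d) → ℝ) : Prop :=
  ContDiff ℝ ∞ φ ∧ HasCompactSupport φ ∧ tsupport φ ⊆ Ω.carrier

/-! ### The space `H¹₀(Ω)` -/

/-- The pairs `(φ, ∇φ)` with `φ ∈ C_c^∞(Ω)`, as a subspace of `L²(Ω) × L²(Ω)ᵈ`. -/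
def testGraph (Ω : LipschitzDomain d) : Submodule ℝ (L2 Ω × L2Vec Ω) where
  carrier := {p | ∃ φ, IsTest Ω φ ∧ p.1 =ᵐ[volume.restrict Ω.carrier] φ ∧
    p.2 =ᵐ[volume.restrict Ω.carrier] gradient φ}
  zero_mem' := by
    refine ⟨fun _ => 0, ⟨contDiff_const, HasCompactSupport.zero, ?_⟩, Lp.coeFn_zero _ _ _, ?_⟩
    · have : tsupport (fun _ : EuclideanSpace ℝ (Fin d) => (0 : ℝ)) = ∅ := by
        rw [tsupport_eq_empty_iff]; rfl
      simp [this]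
    · filter_upwards [Lp.coeFn_zero (EuclideanSpace ℝ (Fin d)) 2 (volume.restrict Ω.carrier)]
        with x hx
      change ((0 : L2Vec Ω) : _ → _) x = _
      rw [hx]
      simp [gradient]
  add_mem' := by
    rintro p q ⟨φ, ⟨h1, h2, h3⟩, h4, h5⟩ ⟨ψ, ⟨k1, k2, k3⟩, k4, k5⟩
    refine ⟨fun x => φ x + ψ x, ⟨h1.add k1, h2.add k2, ?_⟩, ?_, ?_⟩
    · exact (tsupport_add φ ψ).trans (union_subset h3 k3)
    · filter_upwards [h4, k4, Lp.coeFn_add p.1 q.1] with x a b e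
      change (p.1 + q.1 : L2 Ω) x = _
      rw [e, Pi.add_apply, a, b]
    · filter_upwards [h5, k5, Lp.coeFn_add p.2 q.2] with x a b e
      change (p.2 + q.2 : L2Vec Ω) x = _
      rw [e, Pi.add_apply, a, b]
      simp only [gradient]
      rw [← map_add]
      congr 1
      exact (fderiv_fun_add (h1.differentiable (by simp) x) (k1.differentiable (by simp) x)).symm
  smul_mem' := by
    rintro r p ⟨φ, ⟨h1, h2, h3⟩, h4, h5⟩
    refine ⟨fun x => r • φ x, ⟨h1.const_smul r, h2.smul_left (f := fun _ => r), ?_⟩, ?_, ?_⟩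
    · exact (tsupport_smul_subset_right (fun _ => r) φ).trans h3
    · filter_upwards [h4, Lp.coeFn_smul r p.1] with x a e
      change (r • p.1 : L2 Ω) x = _
      rw [e, Pi.smul_apply, a]
    · filter_upwards [h5, Lp.coeFn_smul r p.2] with x a e
      change (r • p.2 : L2Vec Ω) x = _
      rw [e, Pi.smul_apply, a]
      simp only [gradient]
      rw [fderiv_fun_const_smul (h1.differentiable (by simp) x)]
      simp

/-- The pairs `(w, ∇w)` with `w` in the `H¹`-closure of `C_c^∞(Ω)`: the closure in `L²(Ω) × L²(Ω)ᵈ` of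
the pairs `(φ, ∇φ)` of test functions. -/
def h10Graph (Ω : LipschitzDomain d) : Submodule ℝ (L2 Ω × L2Vec Ω) :=
  (testGraph Ω).topologicalClosure

theorem poincare_test (Ω : LipschitzDomain d) {R : ℝ}
    (hR : ∀ x ∈ Ω.carrier, ‖x‖ ≤ R) {φ : EuclideanSpace ℝ (Fin d) → ℝ} (hφ : IsTest Ω φ) :
    ∫ x in Ω.carrier, ‖φ x‖ ^ 2 ≤ 4 * R ^ 2 * ∫ x in Ω.carrier, ‖gradient φ x‖ ^ 2 := by
  obtain ⟨h1, h2, h3⟩ := hφ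
  let i : Fin d := ⟨0, Ω.dim_pos⟩
  let e : EuclideanSpace ℝ (Fin d) := EuclideanSpace.single i 1
  have he : ‖e‖ = 1 := by simp [e]
  have hφ0 : ∀ x, x ∉ Ω.carrier → φ x = 0 := fun x hx =>
    image_eq_zero_of_notMem_tsupport fun h => hx (h3 h)
  have hgrad : ∀ x, x ∉ Ω.carrier → fderiv ℝ φ x = 0 := fun x hx =>
    image_eq_zero_of_notMem_tsupport fun h => hx (h3 (tsupport_fderiv_subset ℝ h))
  have hdiff : Differentiable ℝ φ := h1.differentiable (by simp)
  have hcf : Continuous (fderiv ℝ φ) := h1.continuous_fderiv (by simp)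
  have hc : Continuous φ := h1.continuous
  have hng : ∀ x, ‖gradient φ x‖ = ‖fderiv ℝ φ x‖ := fun x => by simp [gradient]
  have hl : ∀ x, fderiv ℝ (fun y : EuclideanSpace ℝ (Fin d) => y i) x e = 1 := by
    intro x
    have : fderiv ℝ (fun y : EuclideanSpace ℝ (Fin d) => y i) x =
        (EuclideanSpace.proj i : EuclideanSpace ℝ (Fin d) →L[ℝ] ℝ) :=
      (EuclideanSpace.proj i : EuclideanSpace ℝ (Fin d) →L[ℝ] ℝ).fderiv
    rw [this]; simp [e]
  have hsq : ∀ x, fderiv ℝ (fun y => φ y * φ y) x e = 2 * φ x * fderiv ℝ φ x e := by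
    intro x
    rw [fderiv_fun_mul (hdiff x) (hdiff x)]
    simp only [add_apply, smul_apply, smul_eq_mul]
    ring
  have hci : Continuous fun x : EuclideanSpace ℝ (Fin d) => x i := by fun_prop
  have hcfe : Continuous fun x => fderiv ℝ φ x e := hcf.clm_apply continuous_const
  have key := integral_mul_fderiv_eq_neg_fderiv_mul_of_integrable (μ := volume)
    (f := fun x => φ x * φ x) (g := fun y : EuclideanSpace ℝ (Fin d) => y i) (v := e)
    (by
      simp only [hsq]
      refine Continuous.integrable_of_hasCompactSupport (by fun_prop) ?_
      exact ((h2.mul_left (f := fun _ => (2 : ℝ))).mul_right).mul_right)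
    (by
      simp only [hl]
      refine Continuous.integrable_of_hasCompactSupport (by fun_prop) ?_
      exact (h2.mul_right).mul_right)
    (Continuous.integrable_of_hasCompactSupport (by fun_prop) ((h2.mul_right).mul_right))
    (fun x _ => (hdiff x).mul (hdiff x))
    (fun x _ => by fun_prop)
  simp only [hsq, hl, mul_one] at key
  rw [setIntegral_eq_integral_of_forall_compl_eq_zero (fun x hx => by simp [hφ0 x hx]),
    setIntegral_eq_integral_of_forall_compl_eq_zero (fun x hx => by simp [hng, hgrad x hx])]
  simp only [hng]
  have i1 : Integrable (fun x => ‖φ x‖ ^ 2) := by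
    refine Continuous.integrable_of_hasCompactSupport (by fun_prop) ?_
    have := h2.mul_right (f' := φ)
    refine this.mono' fun x hx => subset_tsupport _ ?_
    simpa using hx
  have i2 : Integrable (fun x => ‖fderiv ℝ φ x‖ ^ 2) := by
    refine Continuous.integrable_of_hasCompactSupport (by fun_prop) ?_
    refine (h2.fderiv (𝕜 := ℝ)).mono' fun x hx => subset_tsupport _ ?_
    simpa using hx
  have hpt : ∀ x, -(2 * φ x * fderiv ℝ φ x e * x i) ≤
      (1 / 2) * ‖φ x‖ ^ 2 + 2 * R ^ 2 * ‖fderiv ℝ φ x‖ ^ 2 := by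
    intro x
    by_cases hx : x ∈ Ω.carrier
    · have a1 : |x i| ≤ R := (PiLp.norm_apply_le x i).trans (hR x hx)
      have a2 : |fderiv ℝ φ x e| ≤ ‖fderiv ℝ φ x‖ := by
        have := (fderiv ℝ φ x).le_opNorm e
        rwa [he, mul_one] at this
      have a3 : (fderiv ℝ φ x e * x i) ^ 2 ≤ (‖fderiv ℝ φ x‖ * R) ^ 2 := by
        rw [← sq_abs, abs_mul]
        gcongr
      rw [Real.norm_eq_abs, sq_abs]
      nlinarith [sq_nonneg (φ x + 2 * (fderiv ℝ φ x e * x i))]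
    · rw [hφ0 x hx]
      simp only [mul_zero, zero_mul, neg_zero]
      positivity
  have e1 : ∫ x, ‖φ x‖ ^ 2 = ∫ x, φ x * φ x := by
    congr 1; ext x; rw [Real.norm_eq_abs, sq_abs, sq]
  have hle : ∫ x, ‖φ x‖ ^ 2 ≤
      (1 / 2) * (∫ x, ‖φ x‖ ^ 2) + 2 * R ^ 2 * ∫ x, ‖fderiv ℝ φ x‖ ^ 2 := by
    rw [← integral_const_mul, ← integral_const_mul,
      ← integral_add (i1.const_mul _) (i2.const_mul _), e1, key, ← integral_neg]
    refine integral_mono ?_ ((i1.const_mul _).add (i2.const_mul _)) hpt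
    refine (Continuous.integrable_of_hasCompactSupport (by fun_prop) ?_).neg
    exact ((h2.mul_left (f := fun _ => (2 : ℝ))).mul_right).mul_right
  linarith

theorem exists_poincare_graph (Ω : LipschitzDomain d) :
    ∃ C : ℝ, 0 ≤ C ∧ ∀ w : h10Graph Ω, ‖w.1.1‖ ≤ C * ‖w.1.2‖ := by
  obtain ⟨R, hR0, hR⟩ := Ω.isBounded.exists_pos_norm_le
  refine ⟨2 * R, by positivity, fun w => ?_⟩
  have hcl : IsClosed {p : L2 Ω × L2Vec Ω | ‖p.1‖ ≤ 2 * R * ‖p.2‖} :=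
    isClosed_le (by fun_prop) (by fun_prop)
  have hsub : (testGraph Ω : Set (L2 Ω × L2Vec Ω)) ⊆ {p | ‖p.1‖ ≤ 2 * R * ‖p.2‖} := by
    rintro p ⟨φ, hφ, h4, h5⟩
    have a1 : ‖p.1‖ ^ 2 = ∫ x in Ω.carrier, ‖φ x‖ ^ 2 := by
      rw [← real_inner_self_eq_norm_sq, L2.inner_def]
      refine integral_congr_ae ?_
      filter_upwards [h4] with x hx
      rw [hx, real_inner_self_eq_norm_sq]
    have a2 : ‖p.2‖ ^ 2 = ∫ x in Ω.carrier, ‖gradient φ x‖ ^ 2 := by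
      rw [← real_inner_self_eq_norm_sq, L2.inner_def]
      refine integral_congr_ae ?_
      filter_upwards [h5] with x hx
      rw [hx, real_inner_self_eq_norm_sq]
    have a3 := poincare_test Ω hR hφ
    rw [← a1, ← a2] at a3
    refine (sq_le_sq₀ (norm_nonneg _) (by positivity)).1 ?_
    linarith [mul_pow (2 * R) ‖p.2‖ 2, mul_pow 2 R 2]
  exact closure_minimal hsub hcl w.2

theorem h10Graph_snd_injective (Ω : LipschitzDomain d) : Function.Injective
    ((LinearMap.snd ℝ (L2 Ω) (L2Vec Ω)).comp (h10Graph Ω).subtype) := by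
  rw [← LinearMap.ker_eq_bot, LinearMap.ker_eq_bot']
  intro w hw
  have hw2 : w.1.2 = 0 := hw
  obtain ⟨C, -, hC⟩ := exists_poincare_graph Ω
  have h1 : w.1.1 = 0 := by
    have := hC w
    rw [hw2] at this
    simpa using this
  exact Subtype.ext (Prod.ext h1 hw2)

/-- `H¹₀(Ω)`, the closure of `C_c^∞(Ω)` in the `H¹`-norm; an element is a pair `(w, ∇w)`. -/
def H10 (Ω : LipschitzDomain d) : Type := ↥(h10Graph Ω)

namespace H10

variable {Ω : LipschitzDomain d}

/-- The norm of `H¹₀(Ω)` is `‖w‖ = ‖∇w‖_{L²(Ω)}`. -/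
instance : NormedAddCommGroup (H10 Ω) :=
  NormedAddCommGroup.induced ↥(h10Graph Ω) (L2Vec Ω)
    ((LinearMap.snd ℝ (L2 Ω) (L2Vec Ω)).comp (h10Graph Ω).subtype) (h10Graph_snd_injective Ω)

/-- The inner product of `H¹₀(Ω)` is `(∇w, ∇z)_{L²(Ω)}`. -/
instance : InnerProductSpace ℝ (H10 Ω) where
  toModule := inferInstanceAs (Module ℝ ↥(h10Graph Ω))
  norm_smul_le r w := norm_smul_le r w.1.2
  inner w z := inner ℝ w.1.2 z.1.2
  norm_sq_eq_re_inner w := norm_sq_eq_re_inner (𝕜 := ℝ) w.1.2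
  conj_inner_symm w z := inner_conj_symm w.1.2 z.1.2
  add_left w z y := inner_add_left w.1.2 z.1.2 y.1.2
  smul_left w z r := inner_smul_left w.1.2 z.1.2 r

/-- The function `w ∈ L²(Ω)` underlying an element of `H¹₀(Ω)`. -/
def toFunₗ : H10 Ω →ₗ[ℝ] L2 Ω where
  toFun w := w.1.1
  map_add' _ _ := rfl
  map_smul' _ _ := rfl

/-- The weak gradient `∇w ∈ L²(Ω)ᵈ` of an element of `H¹₀(Ω)`. -/
def grad : H10 Ω →ₗ[ℝ] L2Vec Ω where
  toFun w := w.1.2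
  map_add' _ _ := rfl
  map_smul' _ _ := rfl

theorem norm_def (w : H10 Ω) : ‖w‖ = ‖grad w‖ := rfl

theorem inner_def (w z : H10 Ω) : inner ℝ w z = inner ℝ (grad w) (grad z) := rfl

theorem exists_poincare (Ω : LipschitzDomain d) :
    ∃ C : ℝ, 0 ≤ C ∧ ∀ w : H10 Ω, ‖toFunₗ w‖ ≤ C * ‖w‖ :=
  exists_poincare_graph Ω

end H10

/-- `H⁻¹(Ω)`, the dual of `H¹₀(Ω)`, with the dual norm. -/
abbrev Hneg1 (Ω : LipschitzDomain d) : Type := StrongDual ℝ (H10 Ω)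

/-- The embedding `H¹₀(Ω) → H⁻¹(Ω)`, `⟨w, z⟩ = (w, z)_{L²(Ω)}`. -/
def embed (Ω : LipschitzDomain d) : H10 Ω →L[ℝ] Hneg1 Ω :=
  LinearMap.mkContinuousOfExistsBound₂
    ((innerₗ (L2 Ω)).compl₁₂ H10.toFunₗ H10.toFunₗ) (by
      obtain ⟨C, hC0, hC⟩ := H10.exists_poincare Ω
      refine ⟨C * C, fun w z => ?_⟩
      have h := norm_inner_le_norm (𝕜 := ℝ) (H10.toFunₗ w) (H10.toFunₗ z)
      have h2 := mul_le_mul (hC w) (hC z) (norm_nonneg _) (by positivity)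
      calc _ ≤ _ := h
        _ ≤ _ := h2
        _ = C * C * ‖w‖ * ‖z‖ := by ring)

theorem embed_apply (Ω : LipschitzDomain d) (w z : H10 Ω) :
    embed Ω w z = ∫ x in Ω.carrier, H10.toFunₗ z x * H10.toFunₗ w x := by
  change inner ℝ (H10.toFunₗ w) (H10.toFunₗ z) = _
  rw [L2.inner_def]
  rfl

/-- The weak Dirichlet Laplacian `-Δ : H¹₀(Ω) → H⁻¹(Ω)`, `⟨-Δw, z⟩ = (∇w, ∇z)_{L²(Ω)}`. -/
def negLaplacian (Ω : LipschitzDomain d) : H10 Ω →L[ℝ] Hneg1 Ω :=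
  LinearMap.mkContinuous₂ ((innerₗ (L2Vec Ω)).compl₁₂ H10.grad H10.grad) 1 (fun w z => by
    rw [one_mul]
    exact norm_inner_le_norm (𝕜 := ℝ) (H10.grad w) (H10.grad z))

theorem negLaplacian_apply (Ω : LipschitzDomain d) (w z : H10 Ω) :
    negLaplacian Ω w z = inner ℝ (H10.grad w) (H10.grad z) := rfl

/-! ### Bochner spaces on the time interval `(0, T)` -/

section Bochner

variable (X : Type*) [NormedAddCommGroup X] [NormedSpace ℝ X]

/-- `L²(0, T; X)` with its Bochner norm. -/
abbrev L2Time (T : ℝ) : Type _ := Lp X 2 (volume.restrict (Ioo (0 : ℝ) T))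

variable {X}

/-- `g = ∂ₜ f` weakly on `(0, T)`. -/
def IsWeakDeriv {T : ℝ} (f g : L2Time X T) : Prop :=
  ∀ φ : ℝ → ℝ, ContDiff ℝ ∞ φ → HasCompactSupport φ → tsupport φ ⊆ Ioo 0 T →
    ∫ t in Ioo 0 T, deriv φ t • f t = - ∫ t in Ioo 0 T, φ t • g t

/-- `f(0) = 0` in `X`: the continuous representative of `f` on `[0, T]` exists and vanishes at `0`. -/
def VanishesAtZero {T : ℝ} (f : L2Time X T) : Prop :=
  ∃ F : ℝ → X, ContinuousOn F (Icc 0 T) ∧ f =ᵐ[volume.restrict (Ioo 0 T)] F ∧ F 0 = 0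

theorem integrable_test_smul {T : ℝ} (f : L2Time X T) {φ : ℝ → ℝ} (h1 : Continuous φ)
    (h2 : HasCompactSupport φ) : Integrable (fun t => φ t • f t) (volume.restrict (Ioo 0 T)) := by
  have hf : Integrable f (volume.restrict (Ioo 0 T)) := (Lp.memLp f).integrable (by norm_num)
  obtain ⟨C, hC⟩ := h1.bounded_above_of_compact_support h2
  exact hf.bdd_smul C h1.aestronglyMeasurable (Filter.Eventually.of_forall hC)

theorem IsWeakDeriv.zero {T : ℝ} : IsWeakDeriv (0 : L2Time X T) 0 := by
  intro φ _ _ _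
  have h := Lp.coeFn_zero X 2 (volume.restrict (Ioo (0 : ℝ) T))
  rw [integral_congr_ae (g := fun _ => (0 : X))
      (by filter_upwards [h] with t ht; rw [ht, Pi.zero_apply, smul_zero]),
    integral_congr_ae (f := fun t => φ t • (0 : L2Time X T) t) (g := fun _ => (0 : X))
      (by filter_upwards [h] with t ht; rw [ht, Pi.zero_apply, smul_zero])]
  simp

theorem IsWeakDeriv.add {T : ℝ} {f g f' g' : L2Time X T} (h : IsWeakDeriv f g)
    (h' : IsWeakDeriv f' g') : IsWeakDeriv (f + f') (g + g') := by
  intro φ h1 h2 h3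
  have hd : Continuous (deriv φ) := h1.continuous_deriv (by simp)
  have e : ∀ (ψ : ℝ → ℝ) (a b : L2Time X T), Continuous ψ → HasCompactSupport ψ →
      ∫ t in Ioo 0 T, ψ t • (a + b) t =
        (∫ t in Ioo 0 T, ψ t • a t) + ∫ t in Ioo 0 T, ψ t • b t := by
    intro ψ a b k1 k2
    rw [← integral_add (integrable_test_smul a k1 k2) (integrable_test_smul b k1 k2)]
    refine integral_congr_ae ?_
    filter_upwards [Lp.coeFn_add a b] with t ht
    rw [ht, Pi.add_apply, smul_add]
  rw [e _ _ _ hd h2.deriv, e _ _ _ h1.continuous h2, h φ h1 h2 h3, h' φ h1 h2 h3]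
  abel

theorem IsWeakDeriv.const_smul {T : ℝ} {f g : L2Time X T} (h : IsWeakDeriv f g) (r : ℝ) :
    IsWeakDeriv (r • f) (r • g) := by
  intro φ h1 h2 h3
  have e : ∀ (ψ : ℝ → ℝ) (a : L2Time X T),
      ∫ t in Ioo 0 T, ψ t • (r • a) t = r • ∫ t in Ioo 0 T, ψ t • a t := by
    intro ψ a
    rw [← integral_smul]
    refine integral_congr_ae ?_
    filter_upwards [Lp.coeFn_smul r a] with t ht
    rw [ht, Pi.smul_apply, smul_comm]
  rw [e, e, h φ h1 h2 h3, smul_neg]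

theorem IsWeakDeriv.unique [CompleteSpace X] {T : ℝ} {f g g' : L2Time X T} (h : IsWeakDeriv f g)
    (h' : IsWeakDeriv f g') : g = g' := by
  have h0 := (h.add (h'.const_smul (-1)))
  have e0 : f + (-1 : ℝ) • f = 0 := by simp
  have e1 : g + (-1 : ℝ) • g' = g - g' := by rw [neg_one_smul, sub_eq_add_neg]
  rw [e0, e1] at h0
  have hz : ∀ᵐ t ∂(volume.restrict (Ioo (0 : ℝ) T)), t ∈ Ioo (0 : ℝ) T → (g - g' : L2Time X T) t = 0 := by
    refine isOpen_Ioo.ae_eq_zero_of_integral_contDiff_smul_eq_zero ?_ fun φ h1 h2 h3 => ?_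
    · exact ((Lp.memLp (g - g')).integrable (by norm_num)).locallyIntegrable.locallyIntegrableOn _
    · have := h0 φ h1 h2 h3
      rw [integral_congr_ae (g := fun _ => (0 : X)) (by
        filter_upwards [Lp.coeFn_zero X 2 (volume.restrict (Ioo (0 : ℝ) T))] with t ht
        rw [ht, Pi.zero_apply, smul_zero])] at this
      simpa using this.symm
  rw [← sub_eq_zero]
  refine (Lp.eq_zero_iff_ae_eq_zero).2 ?_
  filter_upwards [hz, ae_restrict_mem measurableSet_Ioo] with t ht ht'
  exact ht ht'

theorem VanishesAtZero.zero {T : ℝ} : VanishesAtZero (0 : L2Time X T) :=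
  ⟨fun _ => 0, continuousOn_const, Lp.coeFn_zero _ _ _, rfl⟩

theorem VanishesAtZero.add {T : ℝ} {f g : L2Time X T} (hf : VanishesAtZero f)
    (hg : VanishesAtZero g) : VanishesAtZero (f + g) := by
  obtain ⟨F, a1, a2, a3⟩ := hf
  obtain ⟨G, b1, b2, b3⟩ := hg
  refine ⟨F + G, a1.add b1, ?_, by simp [a3, b3]⟩
  exact (Lp.coeFn_add f g).trans (a2.add b2)

theorem VanishesAtZero.const_smul {T : ℝ} {f : L2Time X T} (hf : VanishesAtZero f) (r : ℝ) :
    VanishesAtZero (r • f) := by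
  obtain ⟨F, a1, a2, a3⟩ := hf
  exact ⟨r • F, a1.const_smul r, (Lp.coeFn_smul r f).trans (a2.const_smul r), by simp [a3]⟩

end Bochner

/-- The test space `𝕍 = L²(0, T; H¹₀(Ω))`. -/
abbrev TestSpace (Ω : LipschitzDomain d) (T : ℝ) : Type := L2Time (H10 Ω) T

/-- The data space `𝕍* = L²(0, T; H⁻¹(Ω))`. -/
abbrev DataSpace (Ω : LipschitzDomain d) (T : ℝ) : Type := L2Time (Hneg1 Ω) T

/-- A function in `L²(0, T; H¹₀(Ω))`, read as a function in `L²(0, T; H⁻¹(Ω))`. -/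
def embedTime (Ω : LipschitzDomain d) (T : ℝ) : TestSpace Ω T →L[ℝ] DataSpace Ω T :=
  (embed Ω).compLpL 2 (volume.restrict (Ioo 0 T))

/-- `-Δ : L²(0, T; H¹₀(Ω)) → L²(0, T; H⁻¹(Ω))`, acting at almost every time. -/
def negLaplacianTime (Ω : LipschitzDomain d) (T : ℝ) : TestSpace Ω T →L[ℝ] DataSpace Ω T :=
  (negLaplacian Ω).compLpL 2 (volume.restrict (Ioo 0 T))

/-! ### The trial space -/

/-- `{u ∈ L²(0, T; H¹₀(Ω)) ∩ H²(0, T; H⁻¹(Ω)) : u(0) = 0, ∂ₜu(0) = 0}`, as a subspace of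
`L²(0, T; H¹₀(Ω))`; here `u₁ = ∂ₜu` and `u₂ = ∂ₜₜu`. -/
def trialSubmodule (Ω : LipschitzDomain d) (T : ℝ) : Submodule ℝ (TestSpace Ω T) where
  carrier := {u | ∃ u₁ u₂ : DataSpace Ω T,
    IsWeakDeriv (embedTime Ω T u) u₁ ∧ IsWeakDeriv u₁ u₂ ∧
      VanishesAtZero (embedTime Ω T u) ∧ VanishesAtZero u₁}
  zero_mem' := ⟨0, 0, by rw [map_zero]; exact .zero, .zero, by rw [map_zero]; exact .zero, .zero⟩
  add_mem' := by
    rintro u w ⟨u₁, u₂, a1, a2, a3, a4⟩ ⟨w₁, w₂, b1, b2, b3, b4⟩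
    exact ⟨u₁ + w₁, u₂ + w₂, by rw [map_add]; exact a1.add b1, a2.add b2,
      by rw [map_add]; exact a3.add b3, a4.add b4⟩
  smul_mem' := by
    rintro r u ⟨u₁, u₂, a1, a2, a3, a4⟩
    exact ⟨r • u₁, r • u₂, by rw [map_smul]; exact a1.const_smul r, a2.const_smul r,
      by rw [map_smul]; exact a3.const_smul r, a4.const_smul r⟩

theorem exists_dtt {Ω : LipschitzDomain d} {T : ℝ} (u : trialSubmodule Ω T) :
    ∃ u₂ : DataSpace Ω T, ∃ u₁ : DataSpace Ω T,
      IsWeakDeriv (embedTime Ω T u) u₁ ∧ IsWeakDeriv u₁ u₂ := by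
  obtain ⟨u₁, u₂, h1, h2, -, -⟩ := u.2
  exact ⟨u₂, u₁, h1, h2⟩

theorem eq_choose_dtt {Ω : LipschitzDomain d} {T : ℝ} {u : trialSubmodule Ω T}
    {u₁ u₂ : DataSpace Ω T} (h1 : IsWeakDeriv (embedTime Ω T u) u₁) (h2 : IsWeakDeriv u₁ u₂) :
    (exists_dtt u).choose = u₂ := by
  obtain ⟨w, k1, k2⟩ := (exists_dtt u).choose_spec
  rw [k1.unique h1] at k2
  exact k2.unique h2

/-- The weak second time derivative `∂ₜₜu ∈ L²(0, T; H⁻¹(Ω))`, which is unique. -/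
def dttSub (Ω : LipschitzDomain d) (T : ℝ) : trialSubmodule Ω T →ₗ[ℝ] DataSpace Ω T where
  toFun u := (exists_dtt u).choose
  map_add' u w := by
    obtain ⟨u₁, a1, a2⟩ := (exists_dtt u).choose_spec
    obtain ⟨w₁, b1, b2⟩ := (exists_dtt w).choose_spec
    exact eq_choose_dtt (by rw [Submodule.coe_add, map_add]; exact a1.add b1) (a2.add b2)
  map_smul' r u := by
    obtain ⟨u₁, a1, a2⟩ := (exists_dtt u).choose_spec
    exact eq_choose_dtt (by rw [Submodule.coe_smul, map_smul]; exact a1.const_smul r)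
      (a2.const_smul r)

/-- `u ↦ (u, c⁻² ∂ₜₜu)`. -/
def normMap (Ω : LipschitzDomain d) (T c : ℝ) :
    trialSubmodule Ω T →ₗ[ℝ] WithLp 2 (TestSpace Ω T × DataSpace Ω T) :=
  (WithLp.linearEquiv 2 ℝ (TestSpace Ω T × DataSpace Ω T)).symm.toLinearMap.comp
    ((trialSubmodule Ω T).subtype.prod ((c ^ 2)⁻¹ • dttSub Ω T))

theorem normMap_injective (Ω : LipschitzDomain d) (T c : ℝ) :
    Function.Injective (normMap Ω T c) := by
  intro u w h
  exact Subtype.ext (congrArg (fun p => p.fst) h)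

/-- The trial space `𝕌`. Its norm depends on the wave speed `c`. -/
def TrialSpace (Ω : LipschitzDomain d) (T _c : ℝ) : Type := ↥(trialSubmodule Ω T)

namespace TrialSpace

variable {Ω : LipschitzDomain d} {T c : ℝ}

/-- The norm of `𝕌`, `‖u‖² = ‖u‖²_{L²(H¹₀)} + c⁻⁴ ‖∂ₜₜu‖²_{L²(H⁻¹)}`. -/
instance : NormedAddCommGroup (TrialSpace Ω T c) :=
  NormedAddCommGroup.induced ↥(trialSubmodule Ω T) (WithLp 2 (TestSpace Ω T × DataSpace Ω T))
    (normMap Ω T c) (normMap_injective Ω T c)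

instance : NormedSpace ℝ (TrialSpace Ω T c) where
  toModule := inferInstanceAs (Module ℝ ↥(trialSubmodule Ω T))
  norm_smul_le r u := by
    change ‖normMap Ω T c (r • (show trialSubmodule Ω T from u))‖ ≤ ‖r‖ * ‖normMap Ω T c u‖
    rw [map_smul, norm_smul]

/-- The inclusion `𝕌 ⊆ L²(0, T; H¹₀(Ω))`. -/
def toTest : TrialSpace Ω T c →ₗ[ℝ] TestSpace Ω T where
  toFun u := u.1
  map_add' _ _ := rfl
  map_smul' _ _ := rfl

/-- The weak second time derivative `∂ₜₜu ∈ L²(0, T; H⁻¹(Ω))`. -/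
def dtt : TrialSpace Ω T c →ₗ[ℝ] DataSpace Ω T where
  toFun u := dttSub Ω T u
  map_add' u w := (dttSub Ω T).map_add u w
  map_smul' r u := (dttSub Ω T).map_smul r u

theorem dtt_eq {u : TrialSpace Ω T c} {u₁ u₂ : DataSpace Ω T}
    (h1 : IsWeakDeriv (embedTime Ω T u.toTest) u₁) (h2 : IsWeakDeriv u₁ u₂) : u.dtt = u₂ :=
  eq_choose_dtt h1 h2

theorem norm_sq (u : TrialSpace Ω T c) :
    ‖u‖ ^ 2 = ‖toTest u‖ ^ 2 + (c ^ 4)⁻¹ * ‖dtt u‖ ^ 2 := by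
  have h : ‖u‖ ^ 2 = ‖toTest u‖ ^ 2 + ‖(c ^ 2)⁻¹ • dtt u‖ ^ 2 :=
    WithLp.prod_norm_sq_eq_of_L2 (normMap Ω T c u)
  rw [h, norm_smul, mul_pow, norm_inv, norm_pow, Real.norm_eq_abs, sq_abs, inv_pow, ← pow_mul]

end TrialSpace

/-! ### The wave operator and the bilinear forms -/

/-- The bilinear form `∫₀ᵀ (κ ⟨∂ₜₜu, v⟩ + (∇u, ∇v)_{L²(Ω)}) dt` on `𝕌 × 𝕍`. -/
def waveForm {Ω : LipschitzDomain d} {T c : ℝ} (κ : ℝ) (u : TrialSpace Ω T c)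
    (v : TestSpace Ω T) : ℝ :=
  ∫ t in Ioo 0 T, (κ * (u.dtt t) (v t) + inner ℝ (H10.grad (u.toTest t)) (H10.grad (v t)))

/-- The wave operator `ℒ = c⁻² ∂ₜₜ - Δ`, from `𝕌` to `𝕍* = L²(0, T; H⁻¹(Ω))`. -/
def waveOp (Ω : LipschitzDomain d) (T c : ℝ) : TrialSpace Ω T c →L[ℝ] DataSpace Ω T :=
  LinearMap.mkContinuous
    ((c ^ 2)⁻¹ • TrialSpace.dtt + (negLaplacianTime Ω T).toLinearMap.comp TrialSpace.toTest)
    (1 + ‖negLaplacianTime Ω T‖) (fun u => by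
      have h1 : ‖u.toTest‖ ≤ ‖u‖ := WithLp.norm_fst_le _ (normMap Ω T c u)
      have h2 : ‖(c ^ 2)⁻¹ • u.dtt‖ ≤ ‖u‖ := WithLp.norm_snd_le _ (normMap Ω T c u)
      have h3 := (negLaplacianTime Ω T).le_opNorm u.toTest
      refine (norm_add_le _ _).trans ?_
      rw [add_mul, one_mul]
      exact add_le_add h2 (h3.trans (by gcongr)))

theorem waveOp_apply {Ω : LipschitzDomain d} {T c : ℝ} (u : TrialSpace Ω T c) :
    waveOp Ω T c u = (c ^ 2)⁻¹ • u.dtt + negLaplacianTime Ω T u.toTest := rfl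

/-- The inf-sup constant of a form on `X × Y`. The infimum and the supremum are taken over the
non-zero vectors, in the extended reals. -/
def infSup {X Y : Type*} [NormedAddCommGroup X] [NormedAddCommGroup Y] (B : X → Y → ℝ) : EReal :=
  ⨅ u : {u : X // u ≠ 0}, ⨆ v : {v : Y // v ≠ 0}, ((B u v / (‖(u : X)‖ * ‖(v : Y)‖) : ℝ) : EReal)

end WaveInfSup

end

/-! Everything rests on one failure: `κ ∂ₜₜ - Δ` is not bounded below on the trial space. The
culprits are separated functions `u(t) = f(t) w`, where `f` oscillates at the time frequency
matching the spatial frequency of `w`.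

In space, exact eigenfunctions are not needed. For a fixed bump `φ` and a unit vector `e`, the
function `w = φ sin (k ⟨e, x⟩ + θ)` satisfies `-Δw = k² w + O(1)` in `H⁻¹(Ω)`, uniformly in `k` and
`θ` (`exists_residual_bound`), since the commutator terms of size `k` are derivatives of bounded
functions. For a suitable phase, `‖w‖_{L²}` stays away from zero, so testing the residual with `w`
forces `‖∇w‖` to grow with `k` (`exists_quasimode`). As `k² w` equals `-Δw` up to `O(1)`, also
`‖w‖_{H⁻¹} = O(‖∇w‖ / k²)`.

In time, take `f(t) = t² sin (ν t + θ)` with `κ ν² = k²`; the factor `t²` enforces both initial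
conditions. Then `κ f'' w - f Δw = f (-Δw - k² w) + κ (2 sin + 4 t ν cos) w`. The first term is
`O(1)` in `H⁻¹`, the second is `O(ν ‖w‖_{H⁻¹}) = O(‖∇w‖ / k)`, while `‖u‖` is at least a fixed
multiple of `‖∇w‖` (`exists_approximate_kernel`). The quotient is arbitrarily small. Cauchy–Schwarz
turns this into a vanishing inf-sup constant, and an isomorphism would contradict it through the
bound on its inverse. -/

noncomputable section

namespace WaveInfSup

/-! ### Energy of oscillations and sup bounds -/

/-- Of the two shifts `sin (p + 0)` and `sin (p + π / 2)` of an oscillation with amplitude `a`, one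
carries at least half of the energy of the amplitude. -/
theorem exists_phase_half_energy {α : Type*} [MeasurableSpace α] {μ : Measure α} {a p : α → ℝ}
    (ha : MemLp a 2 μ) (hp : AEStronglyMeasurable p μ) :
    ∃ θ : ℝ, (∫ x, a x ^ 2 ∂μ) / 2 ≤ ∫ x, (a x * Real.sin (p x + θ)) ^ 2 ∂μ := by
  have hi : ∀ θ : ℝ, Integrable (fun x => (a x * Real.sin (p x + θ)) ^ 2) μ := by
    intro θ
    refine (ha.integrable_sq).mono' ?_ (Filter.Eventually.of_forall fun x => ?_)
    · exact (ha.1.mul (Real.continuous_sin.comp_aestronglyMeasurable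
        (hp.add aestronglyMeasurable_const))).pow 2
    · rw [Real.norm_eq_abs, abs_of_nonneg (sq_nonneg _), mul_pow]
      exact mul_le_of_le_one_right (sq_nonneg _) (Real.sin_sq_le_one _)
  have hsum : (∫ x, (a x * Real.sin (p x + 0)) ^ 2 ∂μ) +
      ∫ x, (a x * Real.sin (p x + Real.pi / 2)) ^ 2 ∂μ = ∫ x, a x ^ 2 ∂μ := by
    rw [← integral_add (hi _) (hi _)]
    refine integral_congr_ae (Filter.Eventually.of_forall fun x => ?_)
    simp only [add_zero, Real.sin_add_pi_div_two]
    linear_combination a x ^ 2 * Real.sin_sq_add_cos_sq (p x)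
  by_contra! h
  linarith [h 0, h (Real.pi / 2)]

theorem exists_norm_le_of_hasCompactSupport {E F : Type*} [TopologicalSpace E]
    [NormedAddCommGroup F] {f : E → F} (hf : Continuous f) (hc : HasCompactSupport f) :
    ∃ M, 0 ≤ M ∧ ∀ x, ‖f x‖ ≤ M := by
  obtain ⟨M, hM⟩ := hf.bounded_above_of_compact_support hc
  exact ⟨max M 0, le_max_right _ _, fun x => (hM x).trans (le_max_left _ _)⟩

/-! ### Test functions inside `H¹₀(Ω)` -/

variable {d : ℕ} {Ω : LipschitzDomain d}

local notation "𝔼" => EuclideanSpace ℝ (Fin d)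

/-- Lets pointwise bounds on `Ω` be converted into `L²(Ω)` bounds. -/
instance (Ω : LipschitzDomain d) : IsFiniteMeasure (volume.restrict Ω.carrier) :=
  ⟨by rw [Measure.restrict_apply_univ]; exact Ω.isBounded.measure_lt_top⟩

namespace IsTest

variable {φ : EuclideanSpace ℝ (Fin d) → ℝ}

theorem mul_smooth (h : IsTest Ω φ) {s : EuclideanSpace ℝ (Fin d) → ℝ} (hs : ContDiff ℝ ∞ s) :
    IsTest Ω (fun x => φ x * s x) :=
  ⟨h.1.mul hs, h.2.1.mul_right, (tsupport_mul_subset_left (f := φ) (g := s)).trans h.2.2⟩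

theorem eq_zero (h : IsTest Ω φ) {x : EuclideanSpace ℝ (Fin d)} (hx : x ∉ Ω.carrier) : φ x = 0 :=
  image_eq_zero_of_notMem_tsupport fun h' => hx (h.2.2 h')

theorem fderiv_eq_zero (h : IsTest Ω φ) {x : EuclideanSpace ℝ (Fin d)} (hx : x ∉ Ω.carrier) :
    fderiv ℝ φ x = 0 :=
  image_eq_zero_of_notMem_tsupport fun h' => hx (h.2.2 (tsupport_fderiv_subset ℝ h'))

theorem continuous_gradient (h : IsTest Ω φ) : Continuous (gradient φ) :=
  (LinearIsometryEquiv.continuous _).comp (h.1.continuous_fderiv (by simp))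

theorem hasCompactSupport_gradient (h : IsTest Ω φ) : HasCompactSupport (gradient φ) :=
  (h.2.1.fderiv (𝕜 := ℝ)).comp_left (map_zero _)

theorem memLp (h : IsTest Ω φ) : MemLp φ 2 (volume.restrict Ω.carrier) :=
  (h.1.continuous.memLp_of_hasCompactSupport h.2.1).restrict _

theorem memLp_gradient (h : IsTest Ω φ) : MemLp (gradient φ) 2 (volume.restrict Ω.carrier) :=
  (h.continuous_gradient.memLp_of_hasCompactSupport h.hasCompactSupport_gradient).restrict _

/-- A test function as an element of `H¹₀(Ω)`. -/
def toH10 (h : IsTest Ω φ) : H10 Ω :=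
  ⟨(h.memLp.toLp φ, h.memLp_gradient.toLp (gradient φ)),
    (testGraph Ω).le_topologicalClosure
      ⟨φ, h, h.memLp.coeFn_toLp, h.memLp_gradient.coeFn_toLp⟩⟩

theorem toFunₗ_toH10 (h : IsTest Ω φ) : H10.toFunₗ h.toH10 = h.memLp.toLp φ := rfl

theorem grad_toH10 (h : IsTest Ω φ) : H10.grad h.toH10 = h.memLp_gradient.toLp (gradient φ) := rfl

end IsTest

/-- A continuous functional `(z, ∇z) ↦ (G, ∇z) + (H, z)` that vanishes on test functions vanishes on
`H¹₀(Ω)`. -/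
theorem inner_grad_add_inner_eq_zero (G : L2Vec Ω) (H : L2 Ω)
    (h : ∀ ψ, IsTest Ω ψ →
      (∫ x in Ω.carrier, inner ℝ (G x) (gradient ψ x)) + ∫ x in Ω.carrier, H x * ψ x = 0)
    (z : H10 Ω) : inner ℝ G (H10.grad z) + inner ℝ H (H10.toFunₗ z) = 0 := by
  have hcl : IsClosed {p : L2 Ω × L2Vec Ω | inner ℝ G p.2 + inner ℝ H p.1 = 0} :=
    isClosed_eq (by fun_prop) continuous_const
  refine closure_minimal (s := (testGraph Ω : Set (L2 Ω × L2Vec Ω))) ?_ hcl z.2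
  rintro p ⟨ψ, hψ, h4, h5⟩
  change inner ℝ G p.2 + inner ℝ H p.1 = 0
  rw [← h ψ hψ, L2.inner_def, L2.inner_def]
  congr 1
  · refine integral_congr_ae ?_
    filter_upwards [h5] with x hx
    rw [hx]
  · refine integral_congr_ae ?_
    filter_upwards [h4] with x hx
    rw [hx, RCLike.inner_apply, conj_trivial, mul_comm]

/-! ### Oscillating quasimodes of the Dirichlet Laplacian -/

section Quasimode

variable {φ : EuclideanSpace ℝ (Fin d) → ℝ} (e : EuclideanSpace ℝ (Fin d)) (k θ : ℝ)

theorem hasFDerivAt_sin_wave (x : 𝔼) : HasFDerivAt (fun x : 𝔼 => Real.sin (k * inner ℝ e x + θ))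
    ((Real.cos (k * inner ℝ e x + θ) * k) • innerSL ℝ e) x := by
  have h := ((((innerSL ℝ e).hasFDerivAt (x := x)).const_mul k).add_const θ).sin
  simpa [smul_smul] using h

theorem hasFDerivAt_cos_wave (x : 𝔼) : HasFDerivAt (fun x : 𝔼 => Real.cos (k * inner ℝ e x + θ))
    ((-Real.sin (k * inner ℝ e x + θ) * k) • innerSL ℝ e) x := by
  have h := ((((innerSL ℝ e).hasFDerivAt (x := x)).const_mul k).add_const θ).cos
  simpa only [smul_smul, innerSL_apply_apply] using h

theorem contDiff_sin_wave : ContDiff ℝ ∞ (fun x : 𝔼 => Real.sin (k * inner ℝ e x + θ)) :=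
  ((contDiff_const.mul (innerSL ℝ e).contDiff).add contDiff_const).sin

/-- Separates the part of the gradient that stays bounded in `k` from the part of size `k`, which
points in direction `e`. -/
theorem gradient_mul_sin_wave (hφ : IsTest Ω φ) (x : 𝔼) :
    gradient (fun x => φ x * Real.sin (k * inner ℝ e x + θ)) x =
      Real.sin (k * inner ℝ e x + θ) • gradient φ x +
        (k * φ x * Real.cos (k * inner ℝ e x + θ)) • e := by
  refine ext_inner_right ℝ fun v => ?_
  have h := ((hφ.1.differentiable (by simp) x).hasFDerivAt.fun_mul
    (hasFDerivAt_sin_wave e k θ x)).fderiv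
  rw [inner_gradient_left, inner_add_left, real_inner_smul_left, real_inner_smul_left,
    inner_gradient_left, h]
  simp
  ring

/-- The weak form of `-∂ₑ(k φ cos - (∂ₑφ) sin) = k² φ sin + (∂ₑ²φ) sin`, where `sin` and `cos` are those
of `k ⟨e, x⟩ + θ`. -/
theorem integral_wave_by_parts (he : ‖e‖ = 1) (hφ : IsTest Ω φ) {ψ : 𝔼 → ℝ} (hψ : IsTest Ω ψ) :
    ∫ x, ψ x * (-(k ^ 2 * φ x * Real.sin (k * inner ℝ e x + θ)) -
        fderiv ℝ (fun y => fderiv ℝ φ y e) x e * Real.sin (k * inner ℝ e x + θ)) =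
      -∫ x, fderiv ℝ ψ x e * (k * φ x * Real.cos (k * inner ℝ e x + θ) -
        fderiv ℝ φ x e * Real.sin (k * inner ℝ e x + θ)) := by
  have hφe : ContDiff ℝ ∞ (fun y => fderiv ℝ φ y e) :=
    (hφ.1.fderiv_right (m := ∞) (by simp)).clm_apply contDiff_const
  have hψe : ContDiff ℝ ∞ (fun y => fderiv ℝ ψ y e) :=
    (hψ.1.fderiv_right (m := ∞) (by simp)).clm_apply contDiff_const
  have hs := contDiff_sin_wave (d := d) e k θ
  have hd : ∀ x, HasFDerivAt (fun x => k * φ x * Real.cos (k * inner ℝ e x + θ) -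
      fderiv ℝ φ x e * Real.sin (k * inner ℝ e x + θ)) _ x := fun x =>
    (((hφ.1.differentiable (by simp) x).hasFDerivAt.const_mul k).fun_mul
      (hasFDerivAt_cos_wave e k θ x)).fun_sub
      ((hφe.differentiable (by simp) x).hasFDerivAt.fun_mul (hasFDerivAt_sin_wave e k θ x))
  have hd' : ∀ x, fderiv ℝ (fun x => k * φ x * Real.cos (k * inner ℝ e x + θ) -
      fderiv ℝ φ x e * Real.sin (k * inner ℝ e x + θ)) x e =
      -(k ^ 2 * φ x * Real.sin (k * inner ℝ e x + θ)) -
        fderiv ℝ (fun y => fderiv ℝ φ y e) x e * Real.sin (k * inner ℝ e x + θ) := by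
    intro x
    rw [(hd x).fderiv]
    simp [he]
    ring
  have hcψ := hψ.1.continuous
  have hcψ' := hψe.continuous
  have hcφ := hφ.1.continuous
  have hcφ' := hφe.continuous
  have hcφ'' : Continuous fun x => fderiv ℝ (fun y => fderiv ℝ φ y e) x e :=
    (hφe.continuous_fderiv (by simp)).clm_apply continuous_const
  have hsψ' : HasCompactSupport (fun y => fderiv ℝ ψ y e) := hψ.2.1.fderiv_apply (𝕜 := ℝ) e
  have key := integral_mul_fderiv_eq_neg_fderiv_mul_of_integrable (μ := volume) (f := ψ)
    (g := fun x => k * φ x * Real.cos (k * inner ℝ e x + θ) -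
      fderiv ℝ φ x e * Real.sin (k * inner ℝ e x + θ)) (v := e)
    (Continuous.integrable_of_hasCompactSupport (by fun_prop) hsψ'.mul_right)
    (by
      simp only [hd']
      exact Continuous.integrable_of_hasCompactSupport (by fun_prop) hψ.2.1.mul_right)
    (Continuous.integrable_of_hasCompactSupport (by fun_prop) hψ.2.1.mul_right)
    (fun x _ => hψ.1.differentiable (by simp) x) (fun x _ => (hd x).differentiableAt)
  simpa only [hd'] using key

/-- The functions `φ sin (k ⟨e, x⟩ + θ)` are eigenfunctions of the Dirichlet Laplacian up to an error in
`H⁻¹(Ω)` that does not depend on the frequency. -/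
theorem exists_residual_bound (he : ‖e‖ = 1) (hφ : IsTest Ω φ) : ∃ C, 0 ≤ C ∧ ∀ k θ : ℝ,
    ‖negLaplacian Ω (hφ.mul_smooth (contDiff_sin_wave e k θ)).toH10 -
      k ^ 2 • embed Ω (hφ.mul_smooth (contDiff_sin_wave e k θ)).toH10‖ ≤ C := by
  have hφe : ContDiff ℝ ∞ (fun y => fderiv ℝ φ y e) :=
    (hφ.1.fderiv_right (m := ∞) (by simp)).clm_apply contDiff_const
  have hcφ := hφ.1.continuous
  have hcφ' := hφe.continuous
  have hcφ'' : Continuous fun x => fderiv ℝ (fun y => fderiv ℝ φ y e) x e :=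
    (hφe.continuous_fderiv (by simp)).clm_apply continuous_const
  have hsφ' : HasCompactSupport (fun y => fderiv ℝ φ y e) := hφ.2.1.fderiv_apply (𝕜 := ℝ) e
  have hsφ'' : HasCompactSupport (fun x => fderiv ℝ (fun y => fderiv ℝ φ y e) x e) :=
    hsφ'.fderiv_apply (𝕜 := ℝ) e
  obtain ⟨M₁, hM₁, hb₁⟩ :=
    exists_norm_le_of_hasCompactSupport hφ.continuous_gradient hφ.hasCompactSupport_gradient
  obtain ⟨M₂, hM₂, hb₂⟩ := exists_norm_le_of_hasCompactSupport hcφ'' hsφ''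
  obtain ⟨P, hP, hPoin⟩ := H10.exists_poincare Ω
  -- The square root of the volume of `Ω`, in the form in which `Lp.norm_le_of_ae_bound` produces
  -- it.
  set V : ℝ := (measureUnivNNReal (volume.restrict Ω.carrier) : ℝ) ^ (2 : ℝ≥0∞).toReal⁻¹
  have hV0 : 0 ≤ V := by positivity
  refine ⟨V * (2 * M₁) + V * M₂ * P, by positivity, fun k θ => ?_⟩
  set w : H10 Ω := (hφ.mul_smooth (contDiff_sin_wave e k θ)).toH10 with hw
  -- The field `G = (k φ cos - ∂ₑφ sin) e` and its divergence `H` pair to zero with `(∇z, z)`, so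
  -- they may be subtracted from the residual for free. The term `-∂ₑφ sin` is there to cancel `k
  -- ∂ₑφ cos` in the divergence. What remains, `∇w - G` and `-k² w - H`, contains no power of `k`.
  have hG : MemLp (fun x => (k * φ x * Real.cos (k * inner ℝ e x + θ) -
      fderiv ℝ φ x e * Real.sin (k * inner ℝ e x + θ)) • e) 2 (volume.restrict Ω.carrier) := by
    refine (Continuous.memLp_of_hasCompactSupport (by fun_prop) ?_).restrict _
    have h1 : HasCompactSupport fun x => k * φ x * Real.cos (k * inner ℝ e x + θ) :=
      (hφ.2.1.mul_left (f := fun _ => k)).mul_right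
    have h2 : HasCompactSupport fun x => fderiv ℝ φ x e * Real.sin (k * inner ℝ e x + θ) :=
      hsφ'.mul_right
    exact (h1.sub h2).smul_right (f' := fun _ => e)
  have hH : MemLp (fun x => -(k ^ 2 * φ x * Real.sin (k * inner ℝ e x + θ)) -
        fderiv ℝ (fun y => fderiv ℝ φ y e) x e * Real.sin (k * inner ℝ e x + θ)) 2
      (volume.restrict Ω.carrier) := by
    refine (Continuous.memLp_of_hasCompactSupport (by fun_prop) ?_).restrict _
    have h1 : HasCompactSupport fun x => k ^ 2 * φ x * Real.sin (k * inner ℝ e x + θ) :=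
      (hφ.2.1.mul_left (f := fun _ => k ^ 2)).mul_right
    have h2 : HasCompactSupport fun x => fderiv ℝ (fun y => fderiv ℝ φ y e) x e *
        Real.sin (k * inner ℝ e x + θ) := hsφ''.mul_right
    have h3 : HasCompactSupport fun x => -(k ^ 2 * φ x * Real.sin (k * inner ℝ e x + θ)) :=
      h1.comp_left (g := fun y : ℝ => -y) neg_zero
    exact h3.sub h2
  have hzero := inner_grad_add_inner_eq_zero (hG.toLp _) (hH.toLp _) (by
    intro ψ hψ
    have e1 : ∫ x in Ω.carrier, inner ℝ (hG.toLp _ x) (gradient ψ x) =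
        ∫ x in Ω.carrier, fderiv ℝ ψ x e * (k * φ x * Real.cos (k * inner ℝ e x + θ) -
          fderiv ℝ φ x e * Real.sin (k * inner ℝ e x + θ)) := by
      refine integral_congr_ae ?_
      filter_upwards [hG.coeFn_toLp] with x hx
      rw [hx, real_inner_comm, inner_gradient_left, map_smul, smul_eq_mul, mul_comm]
    have e2 : ∫ x in Ω.carrier, hH.toLp _ x * ψ x = ∫ x in Ω.carrier,
        ψ x * (-(k ^ 2 * φ x * Real.sin (k * inner ℝ e x + θ)) -
        fderiv ℝ (fun y => fderiv ℝ φ y e) x e * Real.sin (k * inner ℝ e x + θ)) := by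
      refine integral_congr_ae ?_
      filter_upwards [hH.coeFn_toLp] with x hx
      rw [hx, mul_comm]
    rw [e1, e2, setIntegral_eq_integral_of_forall_compl_eq_zero
        (fun x hx => by simp [hψ.fderiv_eq_zero hx]),
      setIntegral_eq_integral_of_forall_compl_eq_zero (fun x hx => by simp [hψ.eq_zero hx]),
      integral_wave_by_parts e k θ he hφ hψ, add_neg_cancel])
  have hGn : ‖H10.grad w - hG.toLp _‖ ≤ V * (2 * M₁) := by
    refine Lp.norm_le_of_ae_bound (by positivity) ?_
    filter_upwards [Lp.coeFn_sub (H10.grad w) (hG.toLp _), hG.coeFn_toLp,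
      (hφ.mul_smooth (contDiff_sin_wave e k θ)).memLp_gradient.coeFn_toLp] with x h1 h2 h3
    rw [hw, IsTest.grad_toH10] at h1 ⊢
    rw [h1, Pi.sub_apply, h2, h3, gradient_mul_sin_wave e k θ hφ]
    have a1 : |Real.sin (k * inner ℝ e x + θ)| ≤ 1 := Real.abs_sin_le_one _
    have a2 : |fderiv ℝ φ x e| ≤ M₁ := by
      rw [← inner_gradient_left]
      refine (abs_real_inner_le_norm _ _).trans ?_
      rw [he, mul_one]
      exact hb₁ x
    have a3 : Real.sin (k * inner ℝ e x + θ) • gradient φ x +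
        (k * φ x * Real.cos (k * inner ℝ e x + θ)) • e -
        (k * φ x * Real.cos (k * inner ℝ e x + θ) -
          fderiv ℝ φ x e * Real.sin (k * inner ℝ e x + θ)) • e =
        Real.sin (k * inner ℝ e x + θ) • (gradient φ x + fderiv ℝ φ x e • e) := by
      module
    rw [a3, norm_smul, Real.norm_eq_abs]
    calc _ ≤ 1 * (‖gradient φ x‖ + ‖fderiv ℝ φ x e • e‖) := by gcongr; exact norm_add_le _ _
      _ ≤ 1 * (M₁ + M₁) := by
        rw [norm_smul, he, mul_one, Real.norm_eq_abs]
        gcongr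
        exact hb₁ x
      _ = _ := by ring
  have hHn : ‖-(k ^ 2 • H10.toFunₗ w) - hH.toLp _‖ ≤ V * M₂ := by
    refine Lp.norm_le_of_ae_bound (by positivity) ?_
    filter_upwards [Lp.coeFn_sub (-(k ^ 2 • H10.toFunₗ w)) (hH.toLp _), hH.coeFn_toLp,
      (hφ.mul_smooth (contDiff_sin_wave e k θ)).memLp.coeFn_toLp,
      Lp.coeFn_neg (k ^ 2 • H10.toFunₗ w), Lp.coeFn_smul (k ^ 2) (H10.toFunₗ w)]
      with x h1 h2 h3 h4 h5
    rw [h1, Pi.sub_apply, h2, h4, Pi.neg_apply, h5, Pi.smul_apply, hw, IsTest.toFunₗ_toH10, h3]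
    have a3 : -(k ^ 2 • (φ x * Real.sin (k * inner ℝ e x + θ))) -
        (-(k ^ 2 * φ x * Real.sin (k * inner ℝ e x + θ)) -
          fderiv ℝ (fun y => fderiv ℝ φ y e) x e * Real.sin (k * inner ℝ e x + θ)) =
        fderiv ℝ (fun y => fderiv ℝ φ y e) x e * Real.sin (k * inner ℝ e x + θ) := by
      rw [smul_eq_mul]
      ring
    rw [a3, norm_mul, ← mul_one M₂]
    gcongr
    · exact hb₂ x
    · exact Real.abs_sin_le_one _
  refine ContinuousLinearMap.opNorm_le_bound _ (by positivity) fun z => ?_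
  have hval : (negLaplacian Ω w - k ^ 2 • embed Ω w) z =
      inner ℝ (H10.grad w - hG.toLp _) (H10.grad z) +
        inner ℝ (-(k ^ 2 • H10.toFunₗ w) - hH.toLp _) (H10.toFunₗ z) := by
    change inner ℝ (H10.grad w) (H10.grad z) -
      k ^ 2 * inner ℝ (H10.toFunₗ w) (H10.toFunₗ z) = _
    rw [inner_sub_left, inner_sub_left, inner_neg_left, real_inner_smul_left]
    linear_combination hzero z
  rw [hval]
  calc _ ≤ ‖H10.grad w - hG.toLp _‖ * ‖H10.grad z‖ +
        ‖-(k ^ 2 • H10.toFunₗ w) - hH.toLp _‖ * ‖H10.toFunₗ z‖ :=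
      (norm_add_le _ _).trans (add_le_add (norm_inner_le_norm _ _) (norm_inner_le_norm _ _))
    _ ≤ V * (2 * M₁) * ‖z‖ + V * M₂ * (P * ‖z‖) := by
      have := hPoin z
      rw [H10.norm_def z] at this ⊢
      gcongr
    _ = _ := by ring

end Quasimode

/-! ### Quasimodes of large frequency and norm -/

theorem norm_sq_toFunₗ_toH10 {φ : 𝔼 → ℝ} (h : IsTest Ω φ) :
    ‖H10.toFunₗ h.toH10‖ ^ 2 = ∫ x in Ω.carrier, φ x ^ 2 := by
  rw [← real_inner_self_eq_norm_sq, L2.inner_def]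
  refine integral_congr_ae ?_
  filter_upwards [h.memLp.coeFn_toLp] with x hx
  rw [IsTest.toFunₗ_toH10, hx, real_inner_self_eq_norm_sq, Real.norm_eq_abs, sq_abs]

theorem exists_isTest (Ω : LipschitzDomain d) :
    ∃ φ, IsTest Ω φ ∧ 0 < ∫ x in Ω.carrier, φ x ^ 2 := by
  obtain ⟨x₀, hx₀⟩ := Ω.isConnected.nonempty
  obtain ⟨r, hr, hball⟩ := Metric.isOpen_iff.1 Ω.isOpen x₀ hx₀
  let f : ContDiffBump x₀ := ⟨r / 4, r / 2, by positivity, by linarith⟩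
  have hf : IsTest Ω f := ⟨f.contDiff, f.hasCompactSupport, by
    rw [f.tsupport_eq]
    exact (Metric.closedBall_subset_ball (half_lt_self hr)).trans hball⟩
  refine ⟨f, hf, ?_⟩
  rw [setIntegral_eq_integral_of_forall_compl_eq_zero (fun x hx => by simp [hf.eq_zero hx])]
  have hc : Continuous fun x => f x ^ 2 := f.continuous.pow 2
  refine hc.integral_pos_of_hasCompactSupport_nonneg_nonzero ?_ (fun x => sq_nonneg _) (x := x₀) ?_
  · exact f.hasCompactSupport.comp_left (g := fun y : ℝ => y ^ 2) (by simp)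
  · simp [f.one_of_mem_closedBall (Metric.mem_closedBall_self f.rIn_pos.le)]

/-- There are approximate eigenfunctions of the Dirichlet Laplacian of arbitrarily high frequency
`k` and norm, whose error in `H⁻¹(Ω)` stays bounded. -/
theorem exists_quasimode (Ω : LipschitzDomain d) : ∃ C, 0 ≤ C ∧ ∀ N : ℝ, ∃ (k : ℝ) (w : H10 Ω),
    N ≤ k ∧ N ≤ ‖w‖ ∧ ‖negLaplacian Ω w - k ^ 2 • embed Ω w‖ ≤ C := by
  obtain ⟨φ, hφ, hpos⟩ := exists_isTest Ω
  set m := ∫ x in Ω.carrier, φ x ^ 2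
  let e : 𝔼 := EuclideanSpace.single ⟨0, Ω.dim_pos⟩ 1
  have he : ‖e‖ = 1 := by simp [e]
  obtain ⟨C, hC, hres⟩ := exists_residual_bound e he hφ
  refine ⟨C, hC, fun N => ?_⟩
  let L := |N| + 1
  have hL : 1 ≤ L := by simp [L]
  have hNL : N ≤ L := (le_abs_self N).trans (by simp [L])
  -- Chosen so that `k m / 2` exceeds `L (C + L)`, which would bound `k² m / 2` if `‖w‖` were below
  -- `N ≤ L`. Since `L ≥ 1`, also `k ≤ k²`.
  let k := L + (C + L) * L * 2 / m
  have hCL : 0 ≤ (C + L) * L * 2 / m := by positivity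
  have hk : L ≤ k := by simp only [k]; linarith
  obtain ⟨θ, hθ⟩ := exists_phase_half_energy (p := fun x => k * inner ℝ e x) hφ.memLp
    (Continuous.aestronglyMeasurable (by fun_prop))
  set w : H10 Ω := (hφ.mul_smooth (contDiff_sin_wave e k θ)).toH10 with hw
  have hr := hres k θ
  rw [← hw] at hr
  refine ⟨k, w, hNL.trans hk, ?_, hr⟩
  have hm : m / 2 ≤ ‖H10.toFunₗ w‖ ^ 2 := by rw [hw, norm_sq_toFunₗ_toH10]; exact hθ
  -- Testing the residual with `w` itself shows that `k² ‖w‖²_{L²}` exceeds `‖w‖²` by at most `C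
  -- ‖w‖`.
  have hz : (negLaplacian Ω w - k ^ 2 • embed Ω w) w =
      ‖w‖ ^ 2 - k ^ 2 * ‖H10.toFunₗ w‖ ^ 2 := by
    rw [← real_inner_self_eq_norm_sq w, ← real_inner_self_eq_norm_sq (H10.toFunₗ w)]
    rfl
  have hle : |(negLaplacian Ω w - k ^ 2 • embed Ω w) w| ≤ C * ‖w‖ :=
    (ContinuousLinearMap.le_opNorm _ w).trans (mul_le_mul_of_nonneg_right hr (norm_nonneg _))
  rw [hz] at hle
  by_contra! hlt
  have hwL : ‖w‖ ≤ L := hlt.le.trans hNL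
  have h1 : k ^ 2 * (m / 2) ≤ ‖w‖ * (C + ‖w‖) := by
    have := mul_le_mul_of_nonneg_left hm (sq_nonneg k)
    linarith [neg_abs_le (‖w‖ ^ 2 - k ^ 2 * ‖H10.toFunₗ w‖ ^ 2)]
  have h2 : ‖w‖ * (C + ‖w‖) ≤ L * (C + L) := by gcongr
  have h3 : k ≤ k ^ 2 := by nlinarith
  have h4 : k * (m / 2) = L * (m / 2) + (C + L) * L := by simp only [k]; field_simp
  have h5 := mul_le_mul_of_nonneg_right h3 (half_pos hpos).le
  have h6 : 0 < L * (m / 2) := by positivity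
  linarith

/-! ### Separated functions of time and space -/

section SeparatedFunctions

variable {X : Type*} [NormedAddCommGroup X] [NormedSpace ℝ X] (T : ℝ) {f f' : ℝ → ℝ}

theorem memLp_smul_const (hf : Continuous f) (x : X) :
    MemLp (fun t => f t • x) 2 (volume.restrict (Ioo (0 : ℝ) T)) := by
  obtain ⟨C, hC⟩ := (isCompact_Icc (a := (0 : ℝ)) (b := T)).exists_bound_of_continuousOn
    (f := fun t => f t • x) (by fun_prop)
  refine MemLp.of_bound (Continuous.aestronglyMeasurable (by fun_prop)) C ?_
  filter_upwards [ae_restrict_mem measurableSet_Ioo] with t ht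
  exact hC t (Ioo_subset_Icc_self ht)

/-- The separated function `t ↦ f(t) x`. -/
def separated (hf : Continuous f) (x : X) : L2Time X T := (memLp_smul_const T hf x).toLp _

theorem coeFn_separated (hf : Continuous f) (x : X) :
    separated T hf x =ᵐ[volume.restrict (Ioo 0 T)] fun t => f t • x :=
  MemLp.coeFn_toLp _

/-- The vector comes out of the Bochner integral, which leaves scalar integration by parts on the
line; the compact support of the test function removes the boundary terms. -/
theorem isWeakDeriv_separated [CompleteSpace X] (hf : ∀ t, HasDerivAt f (f' t) t) (hc : Continuous f)
    (hc' : Continuous f') (x : X) : IsWeakDeriv (separated T hc x) (separated T hc' x) := by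
  intro φ h1 h2 h3
  have hφ0 : ∀ t, t ∉ Ioo 0 T → φ t = 0 := fun t ht =>
    image_eq_zero_of_notMem_tsupport fun h => ht (h3 h)
  have hdφ0 : ∀ t, t ∉ Ioo 0 T → deriv φ t = 0 := fun t ht =>
    Function.notMem_support.1 fun h => ht (h3 (support_deriv_subset h))
  have hd : Continuous (deriv φ) := h1.continuous_deriv (by simp)
  have hcφ := h1.continuous
  have e : ∀ (ψ g : ℝ → ℝ) (hg : Continuous g), (∀ t, t ∉ Ioo 0 T → ψ t = 0) →
      ∫ t in Ioo 0 T, ψ t • separated T hg x t = (∫ t, ψ t * g t) • x := by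
    intro ψ g hg h0
    have h1 := setIntegral_eq_integral_of_forall_compl_eq_zero (μ := volume) (s := Ioo 0 T)
      (f := fun t => ψ t * g t) (fun t ht => by rw [h0 t ht, zero_mul])
    rw [← h1, ← integral_smul_const]
    refine integral_congr_ae ?_
    filter_upwards [coeFn_separated T hg x] with t ht
    rw [ht, smul_smul]
  rw [e _ _ hc hdφ0, e _ _ hc' hφ0, ← neg_smul]
  congr 1
  have key := integral_mul_deriv_eq_deriv_mul_of_integrable (u := φ) (v := f) (u' := deriv φ)
    (v' := f') (fun t _ => (h1.differentiable (by simp) t).hasDerivAt) (fun t _ => hf t)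
    (Continuous.integrable_of_hasCompactSupport (by fun_prop) h2.mul_right)
    (Continuous.integrable_of_hasCompactSupport (by fun_prop) h2.deriv.mul_right)
    (Continuous.integrable_of_hasCompactSupport (by fun_prop) h2.mul_right)
  rw [key, neg_neg]

theorem vanishesAtZero_separated (hf : Continuous f) (h0 : f 0 = 0) (x : X) :
    VanishesAtZero (separated T hf x) :=
  ⟨fun t => f t • x, by fun_prop, coeFn_separated T hf x, by simp [h0]⟩

theorem norm_sq_separated {H : Type*} [NormedAddCommGroup H] [InnerProductSpace ℝ H]
    (hf : Continuous f) (x : H) :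
    ‖separated T hf x‖ ^ 2 = (∫ t in Ioo 0 T, f t ^ 2) * ‖x‖ ^ 2 := by
  rw [← real_inner_self_eq_norm_sq, L2.inner_def, ← integral_mul_const]
  refine integral_congr_ae ?_
  filter_upwards [coeFn_separated T hf x] with t ht
  rw [ht, real_inner_self_eq_norm_sq, norm_smul, mul_pow, Real.norm_eq_abs, sq_abs]

/-- Spatial operators act on the spatial factor alone, which reduces the wave operator on separated
functions to a computation with scalar coefficients. -/
theorem compLpL_separated {Y : Type*} [NormedAddCommGroup Y] [NormedSpace ℝ Y] (A : X →L[ℝ] Y)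
    (hf : Continuous f) (x : X) :
    A.compLpL 2 (volume.restrict (Ioo 0 T)) (separated T hf x) = separated T hf (A x) := by
  refine Lp.ext ?_
  filter_upwards [A.coeFn_compLpL (separated T hf x), coeFn_separated T hf x,
    coeFn_separated T hf (A x)] with t h1 h2 h3
  rw [h1, h2, h3, map_smul]

end SeparatedFunctions

/-! ### Duality pairing and membership in the trial space -/

/-- Cauchy–Schwarz for the duality pairing of `L²(0, T; X*)` and `L²(0, T; X)`. -/
theorem abs_integral_pairing_le {X : Type*} [NormedAddCommGroup X] [NormedSpace ℝ X] {T : ℝ}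
    (r : L2Time (StrongDual ℝ X) T) (v : L2Time X T) :
    |∫ t in Ioo 0 T, r t (v t)| ≤ ‖r‖ * ‖v‖ := by
  have hr := (Lp.memLp r).norm
  have hv := (Lp.memLp v).norm
  have h : inner ℝ (hr.toLp _) (hv.toLp _) = ∫ t in Ioo 0 T, ‖r t‖ * ‖v t‖ := by
    rw [L2.inner_def]
    refine integral_congr_ae ?_
    filter_upwards [hr.coeFn_toLp, hv.coeFn_toLp] with t h1 h2
    rw [h1, h2, RCLike.inner_apply, conj_trivial, mul_comm]
  calc |∫ t in Ioo 0 T, r t (v t)| ≤ ∫ t in Ioo 0 T, ‖r t‖ * ‖v t‖ :=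
        norm_integral_le_of_norm_le (hr.integrable_mul hv)
          (Filter.Eventually.of_forall fun t => (r t).le_opNorm (v t))
    _ ≤ ‖hr.toLp _‖ * ‖hv.toLp _‖ := h ▸ real_inner_le_norm _ _
    _ = ‖r‖ * ‖v‖ := by rw [Lp.norm_toLp, Lp.norm_toLp, eLpNorm_norm, eLpNorm_norm, Lp.norm_def, Lp.norm_def]

variable {T c : ℝ}

theorem separated_mem_trialSubmodule {f f' f'' : ℝ → ℝ} (hf : ∀ t, HasDerivAt f (f' t) t)
    (hf' : ∀ t, HasDerivAt f' (f'' t) t) (hc : Continuous f) (hc' : Continuous f')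
    (hc'' : Continuous f'') (h0 : f 0 = 0) (h0' : f' 0 = 0) (w : H10 Ω) :
    separated T hc w ∈ trialSubmodule Ω T := by
  refine ⟨separated T hc' (embed Ω w), separated T hc'' (embed Ω w), ?_,
    isWeakDeriv_separated T hf' hc' hc'' _, ?_, vanishesAtZero_separated T hc' h0' _⟩
  · rw [embedTime, compLpL_separated]
    exact isWeakDeriv_separated T hf hc hc' _
  · rw [embedTime, compLpL_separated]
    exact vanishesAtZero_separated T hc h0 _

theorem norm_toTest_le (u : TrialSpace Ω T c) : ‖u.toTest‖ ≤ ‖u‖ :=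
  WithLp.norm_fst_le _ (normMap Ω T c u)

theorem norm_negLaplacian_apply_le (w : H10 Ω) : ‖negLaplacian Ω w‖ ≤ ‖w‖ :=
  ContinuousLinearMap.opNorm_le_bound _ (norm_nonneg _) fun z =>
    norm_inner_le_norm (𝕜 := ℝ) (H10.grad w) (H10.grad z)

/-! ### The approximate kernel of the wave operator -/

/-- The double zero of `t²` at the origin gives both initial conditions for every phase `θ`, which
stays free for the energy bound. -/
theorem hasDerivAt_resonant (ν θ t : ℝ) : HasDerivAt (fun t => t ^ 2 * Real.sin (ν * t + θ))
    (2 * t * Real.sin (ν * t + θ) + t ^ 2 * (ν * Real.cos (ν * t + θ))) t := by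
  have hl : HasDerivAt (fun t => ν * t + θ) ν t := by
    simpa using ((hasDerivAt_id t).const_mul ν).add_const θ
  refine ((hasDerivAt_pow 2 t).fun_mul hl.sin).congr_deriv ?_
  simp only [Nat.cast_ofNat, Nat.reduceSub, pow_one]
  ring

theorem hasDerivAt_deriv_resonant (ν θ t : ℝ) : HasDerivAt
    (fun t => 2 * t * Real.sin (ν * t + θ) + t ^ 2 * (ν * Real.cos (ν * t + θ)))
    (2 * Real.sin (ν * t + θ) + 4 * t * ν * Real.cos (ν * t + θ) -
      ν ^ 2 * (t ^ 2 * Real.sin (ν * t + θ))) t := by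
  have hl : HasDerivAt (fun t => ν * t + θ) ν t := by
    simpa using ((hasDerivAt_id t).const_mul ν).add_const θ
  refine ((((hasDerivAt_id t).const_mul 2).fun_mul hl.sin).fun_add
    ((hasDerivAt_pow 2 t).fun_mul (hl.cos.const_mul ν))).congr_deriv ?_
  simp
  ring

/-- The operator `κ ∂ₜₜ - Δ` is not bounded below: it nearly annihilates `t² sin (ν t + θ) w` when `w` is
an approximate eigenfunction of `-Δ` for a large eigenvalue `κ ν²`. -/
theorem exists_approximate_kernel (Ω : LipschitzDomain d) (c : ℝ) (hT : 0 < T) {κ ε : ℝ}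
    (hκ : 0 < κ) (hε : 0 < ε) : ∃ u : TrialSpace Ω T c, u ≠ 0 ∧
      ‖κ • u.dtt + negLaplacianTime Ω T u.toTest‖ ≤ ε * ‖u‖ := by
  obtain ⟨C, hC, hq⟩ := exists_quasimode Ω
  set V : ℝ := (measureUnivNNReal (volume.restrict (Ioo 0 T)) : ℝ) ^ (2 : ℝ≥0∞).toReal⁻¹
  have hV0 : 0 ≤ V := by positivity
  -- Half of `∫₀ᵀ t⁴ dt = T⁵ / 5` survives the oscillation for a good phase, whence `q ‖w‖ ≤ ‖u‖`.
  set q : ℝ := Real.sqrt (T ^ 5 / 10) with hqdef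
  have hq0 : 0 < q := by positivity
  -- A residual of size `η ‖w‖` at almost every time has `L²` norm at most `ε q ‖w‖`; the `1` keeps
  -- the denominator positive without a lower bound on `V`.
  set η : ℝ := ε * q / (V + 1) with hη
  have hη0 : 0 < η := by positivity
  set D : ℝ := 2 + 4 * T / Real.sqrt κ with hD
  have hD0 : 0 < D := by positivity
  -- The summands serve in turn for `1 ≤ k` and `1 ≤ ‖w‖`, for `C ≤ ‖w‖`, for the quasimode error,
  -- and for the error from differentiating `t²`; each error gets half of `η ‖w‖`.
  obtain ⟨k, w, hk, hw, hres⟩ := hq (1 + C + 2 * T ^ 2 * C / η + 4 * κ * D / η)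
  have p1 : 0 ≤ 2 * T ^ 2 * C / η := by positivity
  have p2 : 0 ≤ 4 * κ * D / η := by positivity
  have hk1 : 1 ≤ k := by linarith
  have hw1 : 1 ≤ ‖w‖ := by linarith
  have hwC : C ≤ ‖w‖ := by linarith
  have hw2 : T ^ 2 * C ≤ η / 2 * ‖w‖ := by
    have : 2 * T ^ 2 * C / η ≤ ‖w‖ := by linarith
    rw [div_le_iff₀ hη0] at this
    linarith
  have hk2 : 2 * κ * D ≤ η / 2 * k := by
    have : 4 * κ * D / η ≤ k := by linarith
    rw [div_le_iff₀ hη0] at this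
    linarith
  set ν : ℝ := k / Real.sqrt κ with hν
  have hν0 : 0 < ν := by positivity
  have hκν : κ * ν ^ 2 = k ^ 2 := by
    rw [hν, div_pow, Real.sq_sqrt hκ.le]
    field_simp
  have hamp : MemLp (fun t : ℝ => t ^ 2) 2 (volume.restrict (Ioo 0 T)) := by
    simpa using memLp_smul_const T (f := fun t : ℝ => t ^ 2) (by fun_prop) (1 : ℝ)
  obtain ⟨θ, hθ⟩ := exists_phase_half_energy (p := fun t => ν * t) hamp
    (Continuous.aestronglyMeasurable (by fun_prop))
  have hT5 : ∫ t in Ioo 0 T, (t ^ 2) ^ 2 = T ^ 5 / 5 := by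
    rw [← integral_Ioc_eq_integral_Ioo, ← intervalIntegral.integral_of_le hT.le]
    simp only [← pow_mul]
    rw [integral_pow]
    norm_num
  rw [hT5] at hθ
  have hc : Continuous fun t => t ^ 2 * Real.sin (ν * t + θ) := by fun_prop
  have hc' : Continuous fun t =>
    2 * t * Real.sin (ν * t + θ) + t ^ 2 * (ν * Real.cos (ν * t + θ)) := by fun_prop
  have hc'' : Continuous fun t => 2 * Real.sin (ν * t + θ) + 4 * t * ν * Real.cos (ν * t + θ) -
      ν ^ 2 * (t ^ 2 * Real.sin (ν * t + θ)) := by fun_prop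
  have hmem : separated T hc w ∈ trialSubmodule Ω T :=
    separated_mem_trialSubmodule (hasDerivAt_resonant ν θ) (hasDerivAt_deriv_resonant ν θ)
      hc hc' hc'' (by simp) (by simp) w
  let u : TrialSpace Ω T c := ⟨separated T hc w, hmem⟩
  have htest : u.toTest = separated T hc w := rfl
  have hdtt : u.dtt = separated T hc'' (embed Ω w) :=
    TrialSpace.dtt_eq (u₁ := separated T hc' (embed Ω w))
      (by
        rw [htest, embedTime, compLpL_separated]
        exact isWeakDeriv_separated T (hasDerivAt_resonant ν θ) hc hc' _)
      (isWeakDeriv_separated T (hasDerivAt_deriv_resonant ν θ) hc' hc'' _)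
  have hlow : q * ‖w‖ ≤ ‖u‖ := by
    refine le_trans ?_ (norm_toTest_le u)
    refine (sq_le_sq₀ (by positivity) (norm_nonneg _)).1 ?_
    rw [htest, norm_sq_separated, mul_pow, hqdef, Real.sq_sqrt (by positivity)]
    gcongr
    linarith
  -- The quasimode equation read backwards: `k² w` is `-Δw` up to an error `C ≤ ‖w‖`. This gains two
  -- powers of `k`, against the one lost to the factor `ν`.
  have hemb : k ^ 2 * ‖embed Ω w‖ ≤ 2 * ‖w‖ := by
    have h1 : k ^ 2 • embed Ω w =
        negLaplacian Ω w - (negLaplacian Ω w - k ^ 2 • embed Ω w) := by abel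
    have h2 : ‖k ^ 2 • embed Ω w‖ = k ^ 2 * ‖embed Ω w‖ := by
      rw [norm_smul, Real.norm_eq_abs, abs_of_nonneg (sq_nonneg k)]
    rw [← h2, h1]
    refine (norm_sub_le _ _).trans ?_
    linarith [norm_negLaplacian_apply_le w]
  have hamp2 : κ * (2 + 4 * T * ν) * ‖embed Ω w‖ ≤ η / 2 * ‖w‖ := by
    have h1 : 2 + 4 * T * ν ≤ k * D := by
      have : k * D = 2 * k + 4 * T * ν := by rw [hD, hν]; ring
      linarith
    have h2 : κ * (2 + 4 * T * ν) ≤ κ * (k * D) := by gcongr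
    have h3 : κ * (k * D) ≤ η / 4 * k ^ 2 := by nlinarith
    calc _ ≤ η / 4 * k ^ 2 * ‖embed Ω w‖ := 
        mul_le_mul_of_nonneg_right (h2.trans h3) (norm_nonneg _)
      _ = η / 4 * (k ^ 2 * ‖embed Ω w‖) := by ring
      _ ≤ η / 4 * (2 * ‖w‖) := by gcongr
      _ = _ := by ring
  refine ⟨u, fun h => ?_, ?_⟩
  · rw [h, norm_zero] at hlow
    have : 0 < q * ‖w‖ := by positivity
    linarith
  have hae : ∀ᵐ t ∂(volume.restrict (Ioo 0 T)),
      ‖(κ • u.dtt + negLaplacianTime Ω T u.toTest : DataSpace Ω T) t‖ ≤ η * ‖w‖ := by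
    rw [htest, hdtt, negLaplacianTime, compLpL_separated]
    filter_upwards [ae_restrict_mem measurableSet_Ioo,
      Lp.coeFn_add (κ • separated T hc'' (embed Ω w)) (separated T hc (negLaplacian Ω w)),
      Lp.coeFn_smul κ (separated T hc'' (embed Ω w)), coeFn_separated T hc'' (embed Ω w),
      coeFn_separated T hc (negLaplacian Ω w)] with t ht h1 h2 h3 h4
    rw [h1, Pi.add_apply, h2, Pi.smul_apply, h3, h4]
    -- By `κ ν² = k²`, the leading part of `κ f''` joins `-Δw` to form the quasimode residual.
    have hsplit : κ • (2 * Real.sin (ν * t + θ) + 4 * t * ν * Real.cos (ν * t + θ) -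
        ν ^ 2 * (t ^ 2 * Real.sin (ν * t + θ))) • embed Ω w +
        (t ^ 2 * Real.sin (ν * t + θ)) • negLaplacian Ω w =
        (t ^ 2 * Real.sin (ν * t + θ)) • (negLaplacian Ω w - k ^ 2 • embed Ω w) +
        (κ * (2 * Real.sin (ν * t + θ) + 4 * t * ν * Real.cos (ν * t + θ))) • embed Ω w := by
      rw [← hκν]
      module
    have hs := Real.abs_sin_le_one (ν * t + θ)
    have hcos := Real.abs_cos_le_one (ν * t + θ)
    have b1 : |t ^ 2 * Real.sin (ν * t + θ)| ≤ T ^ 2 := by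
      rw [abs_mul, abs_of_nonneg (sq_nonneg t), ← mul_one (T ^ 2)]
      have := ht.1.le
      gcongr
      exact ht.2.le
    have b2 : |κ * (2 * Real.sin (ν * t + θ) + 4 * t * ν * Real.cos (ν * t + θ))| ≤
        κ * (2 + 4 * T * ν) := by
      rw [abs_mul, abs_of_pos hκ]
      gcongr
      refine (abs_add_le _ _).trans ?_
      rw [abs_mul, abs_mul (4 * t * ν), abs_of_pos (by norm_num : (0 : ℝ) < 2),
        abs_of_nonneg (by have := ht.1; positivity : 0 ≤ 4 * t * ν)]
      have h4 : 4 * t * ν ≤ 4 * T * ν := by gcongr; exact ht.2.le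
      have h5 : 4 * t * ν * |Real.cos (ν * t + θ)| ≤ 4 * T * ν * 1 := by gcongr
      linarith
    rw [hsplit]
    refine (norm_add_le _ _).trans ?_
    rw [norm_smul, norm_smul, Real.norm_eq_abs, Real.norm_eq_abs]
    calc _ ≤ T ^ 2 * C + κ * (2 + 4 * T * ν) * ‖embed Ω w‖ := by gcongr
      _ ≤ η * ‖w‖ := by linarith
  have hn := Lp.norm_le_of_ae_bound (by positivity) hae
  calc _ ≤ V * (η * ‖w‖) := hn
    _ ≤ (V + 1) * (η * ‖w‖) := by gcongr; linarith
    _ = ε * (q * ‖w‖) := by rw [hη]; field_simp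
    _ ≤ ε * ‖u‖ := by gcongr

/-! ### The inf-sup constant -/

theorem waveForm_eq_integral (κ : ℝ) (u : TrialSpace Ω T c) (v : TestSpace Ω T) :
    waveForm κ u v =
      ∫ t in Ioo 0 T, (κ • u.dtt + negLaplacianTime Ω T u.toTest : DataSpace Ω T) t (v t) := by
  refine integral_congr_ae ?_
  filter_upwards [Lp.coeFn_add (κ • u.dtt) (negLaplacianTime Ω T u.toTest),
    Lp.coeFn_smul κ u.dtt, (negLaplacian Ω).coeFn_compLpL u.toTest] with t h1 h2 h3
  rw [h1, Pi.add_apply, h2, Pi.smul_apply, negLaplacianTime, h3]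
  rfl

theorem waveForm_neg (κ : ℝ) (u : TrialSpace Ω T c) (v : TestSpace Ω T) :
    waveForm κ u (-v) = -waveForm κ u v := by
  rw [waveForm_eq_integral, waveForm_eq_integral, ← integral_neg]
  refine integral_congr_ae ?_
  filter_upwards [Lp.coeFn_neg v] with t ht
  rw [ht, Pi.neg_apply, map_neg]

theorem infSup_waveForm_eq_zero (Ω : LipschitzDomain d) (c : ℝ) (hT : 0 < T) {κ : ℝ}
    (hκ : 0 < κ) :
    infSup (fun (u : TrialSpace Ω T c) (v : TestSpace Ω T) => waveForm κ u v) = 0 := by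
  refine le_antisymm ?_ ?_
  · refine EReal.le_of_forall_lt_iff_le.1 fun ε hε => ?_
    have hε0 : 0 < ε := by exact_mod_cast hε
    obtain ⟨u, hu, hle⟩ := exists_approximate_kernel Ω c hT hκ hε0
    refine (iInf_le _ (⟨u, hu⟩ : {u : TrialSpace Ω T c // u ≠ 0})).trans (iSup_le fun v => ?_)
    have hu0 := norm_pos_iff.2 hu
    have hv0 := norm_pos_iff.2 v.2
    rw [EReal.coe_le_coe_iff, div_le_iff₀ (by positivity)]
    beta_reduce
    rw [waveForm_eq_integral]
    calc _ ≤ _ := (le_abs_self _).trans (abs_integral_pairing_le _ _)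
      _ ≤ ε * ‖u‖ * ‖(v : TestSpace Ω T)‖ := by gcongr
      _ = _ := by ring
  -- The supremum is nonnegative because one of `v = u` and `v = -u` gives a nonnegative value; both
  -- are admissible since the inclusion of the trial space into the test space is injective.
  · refine le_iInf fun u => ?_
    have hv : u.1.toTest ≠ 0 := fun h => u.2 (Subtype.ext h)
    rcases le_total 0 (waveForm κ u.1 u.1.toTest) with h | h
    · refine le_iSup_of_le ⟨u.1.toTest, hv⟩ ?_
      exact_mod_cast div_nonneg h (by positivity)
    · refine le_iSup_of_le ⟨-u.1.toTest, neg_ne_zero.2 hv⟩ ?_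
      have : 0 ≤ waveForm κ u.1 (-u.1.toTest) := by rw [waveForm_neg]; linarith
      exact_mod_cast div_nonneg this (by positivity)

/-- The wave operator is not bounded below. -/
theorem not_waveOp_bounded_below (Ω : LipschitzDomain d) (hT : 0 < T) (hc : 0 < c) {C : ℝ}
    (hC : 0 < C) : ∃ u : TrialSpace Ω T c, ‖waveOp Ω T c u‖ < C * ‖u‖ := by
  obtain ⟨u, hu, hle⟩ := exists_approximate_kernel Ω c hT (κ := (c ^ 2)⁻¹) (by positivity)
    (half_pos hC)
  refine ⟨u, hle.trans_lt ?_⟩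
  have := norm_pos_iff.2 hu
  gcongr
  linarith

end WaveInfSup

end

/-! ### The theorem -/

theorem corollary3p3 {d : ℕ} (Ω : WaveInfSup.LipschitzDomain d) {T c : ℝ} (hT : 0 < T) (hc : 0 < c) :
    -- the inf-sup constant of the form induced by the wave operator is zero,
    WaveInfSup.infSup (fun (u : WaveInfSup.TrialSpace Ω T c) (v : WaveInfSup.TestSpace Ω T) =>
      WaveInfSup.waveForm (c ^ 2)⁻¹ u v) = 0 ∧
    -- and so is that of the form without the factor `c⁻²`;
    WaveInfSup.infSup (fun (u : WaveInfSup.TrialSpace Ω T c) (v : WaveInfSup.TestSpace Ω T) =>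
      WaveInfSup.waveForm 1 u v) = 0 ∧
    -- the norms of the solution and of the datum are not equivalent,
    (¬ ∃ C₁ C₂ : ℝ, 0 < C₁ ∧ C₁ ≤ C₂ ∧ ∀ u : WaveInfSup.TrialSpace Ω T c,
      C₁ * ‖u‖ ≤ ‖WaveInfSup.waveOp Ω T c u‖ ∧ ‖WaveInfSup.waveOp Ω T c u‖ ≤ C₂ * ‖u‖) ∧
    -- and the wave operator is not an isomorphism from the trial space onto the data space.
    ¬ ∃ e : WaveInfSup.TrialSpace Ω T c ≃L[ℝ] WaveInfSup.DataSpace Ω T,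
      ∀ u, e u = WaveInfSup.waveOp Ω T c u := by
  refine ⟨WaveInfSup.infSup_waveForm_eq_zero Ω c hT (by positivity),
    WaveInfSup.infSup_waveForm_eq_zero Ω c hT one_pos, ?_, ?_⟩
  · rintro ⟨C₁, C₂, hC₁, -, h⟩
    obtain ⟨u, hu⟩ := WaveInfSup.not_waveOp_bounded_below Ω hT hc hC₁
    exact absurd (h u).1 (not_le.2 hu)
  · rintro ⟨e, he⟩
    -- The added `1` makes `K` invertible even if the inverse had norm zero.
    let K : ℝ := ‖(e.symm : WaveInfSup.DataSpace Ω T →L[ℝ] WaveInfSup.TrialSpace Ω T c)‖ + 1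
    have hK : 0 < K := by positivity
    obtain ⟨u, hu⟩ := WaveInfSup.not_waveOp_bounded_below Ω hT hc (inv_pos.2 hK)
    have h1 : ‖u‖ ≤ K * ‖e u‖ := by
      have h := (e.symm : WaveInfSup.DataSpace Ω T →L[ℝ] WaveInfSup.TrialSpace Ω T c).le_opNorm (e u)
      simp only [ContinuousLinearEquiv.coe_coe, ContinuousLinearEquiv.symm_apply_apply] at h
      refine h.trans ?_
      gcongr
      simp [K]
    rw [← he, inv_mul_eq_div, lt_div_iff₀ hK] at hu
    linarith
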